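/- For $n\in\mathbb{N}$ regard $\mathbb{Z}^n$ as the graph in which $x$ and $y$ are adjacent exactly when $y=x\pm e_i$ for some $i\in[n]=\{1,\dots,n\}$, where $e_1,\dots,e_n$ is the standard basis, and let $\Gamma(x)$ denote the set of the $2n$ neighbours of $x$. A set $X\subseteq\mathbb{Z}^n$ is $p$-biased if $|\Gamma(x)\cap X|=2pn$ for all $x\in\mathbb{Z}^n$. A biased partition of $\mathbb{Z}^n$ is a partition $\{X_i\}_{i\in[2n]}$ of $\mathbb{Z}^n$ into $2n$ sets, each of which is $\frac{1}{2n}$-biased. Two biased partitions $\{X_i\}_{i\in[2n]}$ and $\{Y_i\}_{i\in[2n]}$ of $\mathbb{Z}^n$ are isomorphic if there exist a graph automorphism $\phi$ of $\mathbb{Z}^n$ and a permutation $\sigma$ of $[2n]$ such that $\phi(X_i)=Y_{\sigma(i)}$ for all $i\in[2n]$. **Theorem.** For every integer $n>1$ there are exactly $2^{\aleph_0}$ non-isomorphic biased partitions of $\mathbb{Z}^n$; that is, the set of isomorphism classes of biased partitions of $\mathbb{Z}^n$ has cardinality $2^{\aleph_0}$. -/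

import Mathlib

/-- The integer lattice `ℤ^n` as a graph: its edges are the pairs `{x, x + e_i}`. -/
def latticeGraph (n : ℕ) : SimpleGraph (Fin n → ℤ) where
  Adj x y := ∃ i : Fin n, y = x + Pi.single i 1 ∨ x = y + Pi.single i 1
  symm := ⟨fun _ _ ⟨i, h⟩ => ⟨i, h.symm⟩⟩
  loopless := ⟨by
    rintro x ⟨i, h | h⟩ <;> simpa using congrFun h i⟩

/-- A set `X ⊆ ℤ^n` is `p`-biased if every vertex `x` of `ℤ^n` has exactly `2pn`
of its `2n` neighbours in `X`. -/
def IsBiasedSet (n : ℕ) (p : ℝ) (X : Set (Fin n → ℤ)) : Prop :=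
  ∀ x : Fin n → ℤ, (((latticeGraph n).neighborSet x ∩ X).ncard : ℝ) = 2 * p * n

/-- A biased partition of `ℤ^n`: a partition of `ℤ^n` into `2n` sets, indexed by
`2n` labels, each of which is `1/(2n)`-biased. -/
structure BiasedPartition (n : ℕ) where
  part : Fin (2 * n) → Set (Fin n → ℤ)
  disjoint : Pairwise fun i j => Disjoint (part i) (part j)
  cover : ⋃ i, part i = Set.univ
  biased : ∀ i, IsBiasedSet n (1 / (2 * n)) (part i)

/-- Two biased partitions are isomorphic if some graph automorphism of `ℤ^n` carries
the parts of the first to the parts of the second, up to a permutation of the labels. -/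
def BiasedPartition.Isomorphic {n : ℕ} (X Y : BiasedPartition n) : Prop :=
  ∃ (φ : latticeGraph n ≃g latticeGraph n) (σ : Equiv.Perm (Fin (2 * n))),
    ∀ i, φ '' X.part i = Y.part (σ i)

theorem BiasedPartition.isomorphic_equivalence (n : ℕ) :
    Equivalence (BiasedPartition.Isomorphic (n := n)) where
  refl X := ⟨SimpleGraph.Iso.refl, Equiv.refl _, fun i => by simp [SimpleGraph.Iso.refl]⟩
  symm := by
    rintro X Y ⟨φ, σ, h⟩
    refine ⟨φ.symm, σ.symm, fun i => ?_⟩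
    have h1 := h (σ.symm i)
    rw [Equiv.apply_symm_apply] at h1
    rw [← h1, Set.image_image]
    simp
  trans := by
    rintro X Y Z ⟨φ, σ, h⟩ ⟨ψ, τ, k⟩
    refine ⟨φ.trans ψ, σ.trans τ, fun i => ?_⟩
    rw [Equiv.trans_apply, ← k, ← h, Set.image_image]
    rfl

/-- Isomorphism as an equivalence relation; the classes of its quotient are the
isomorphism classes of biased partitions of `ℤ^n`. -/
def BiasedPartition.isoSetoid (n : ℕ) : Setoid (BiasedPartition n) :=
  ⟨BiasedPartition.Isomorphic, BiasedPartition.isomorphic_equivalence n⟩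

/-! Being `1/(2n)`-biased means that each vertex sees each class exactly once. The form `∑ (2i+1)
x_i` changes along the `2n` steps by `±1, ±3, ..., ±(2n-1)`, distinct modulo `4n`, so its residues
colour the lattice suitably. Adding `2n` interchanges the residues of the steps `e_i` and
`-e_{n-1-i}`. These two steps change `x_0 - x_{n-1}` equally, so `2n` may be added on any union of
level sets of this difference (`twistedColor_step_injective`). This yields `2^ℵ₀` labelled
partitions (`twistedPartition_injective`). An automorphism is determined on a ball of radius one
(`FixesBall.all`), so there are countably many, isomorphism classes are countable, and `2^ℵ₀`
classes remain. -/

/-- The signed standard basis vector `e_i` (for `(i, true)`) or `-e_i` (for `(i, false)`). -/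
def latticeStep {n : ℕ} (u : Fin n × Bool) : Fin n → ℤ :=
  Pi.single u.1 (if u.2 then 1 else -1)

theorem latticeStep_apply {n : ℕ} (u : Fin n × Bool) (k : Fin n) :
    latticeStep u k = if k = u.1 then (if u.2 then 1 else -1) else 0 := by
  simp [latticeStep, Pi.single_apply]

theorem latticeStep_injective {n : ℕ} :
    Function.Injective (latticeStep : Fin n × Bool → Fin n → ℤ) := by
  rintro ⟨i, s⟩ ⟨j, t⟩ h
  have h1 := congrFun h i
  simp only [latticeStep_apply] at h1
  rcases eq_or_ne i j with rfl | hij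
  · cases s <;> cases t <;> simp at h1 ⊢
  · cases s <;> simp [hij] at h1

theorem latticeGraph_adj_iff {n : ℕ} {x y : Fin n → ℤ} :
    (latticeGraph n).Adj x y ↔ ∃ u, y = x + latticeStep u := by
  constructor
  · rintro ⟨i, h | h⟩
    · exact ⟨(i, true), by simpa [latticeStep] using h⟩
    · refine ⟨(i, false), ?_⟩
      rw [h, latticeStep]
      ext k
      by_cases hk : k = i <;> simp [hk]
  · rintro ⟨⟨i, _ | _⟩, rfl⟩
    · refine ⟨i, Or.inr ?_⟩
      ext k
      by_cases hk : k = i <;> simp [latticeStep, hk]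
    · exact ⟨i, Or.inl (by simp [latticeStep])⟩

theorem latticeGraph_adj_step {n : ℕ} (x : Fin n → ℤ) (u : Fin n × Bool) :
    (latticeGraph n).Adj x (x + latticeStep u) :=
  latticeGraph_adj_iff.2 ⟨u, rfl⟩

/-- Two neighbours of `x` in different directions have only one common neighbour besides `x`. -/
theorem eq_or_eq_of_step_add_step_eq {n : ℕ} {u v a b : Fin n × Bool} (huv : u.1 ≠ v.1)
    (h : latticeStep u + latticeStep a = latticeStep v + latticeStep b) :
    latticeStep u + latticeStep a = 0 ∨ a = v := by
  by_cases ha : a.1 = u.1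
  · left
    have h1 := congrFun h v.1
    simp only [Pi.add_apply, latticeStep_apply, huv.symm, ha, if_true, if_false] at h1
    have hb : v.1 = b.1 := by
      by_contra hb
      rw [if_neg hb] at h1
      split_ifs at h1 <;> omega
    have h2 := congrFun h u.1
    simp only [Pi.add_apply, latticeStep_apply, huv, ha, ← hb, if_true, if_false] at h2
    ext k
    simp only [Pi.add_apply, latticeStep_apply, ha, Pi.zero_apply]
    by_cases hk : k = u.1
    · simp only [hk, if_true]; omega
    · simp [hk]
  · right
    have h1 := congrFun h u.1
    simp only [Pi.add_apply, latticeStep_apply, huv, Ne.symm ha, if_true, if_false] at h1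
    have hb : u.1 = b.1 := by
      by_contra hb
      rw [if_neg hb] at h1
      split_ifs at h1 <;> omega
    rw [if_pos hb] at h1
    have hub : u = b := by
      refine Prod.ext hb ?_
      cases hu : u.2 <;> cases hb' : b.2 <;> simp [hu, hb'] at h1 ⊢
    rw [hub, add_comm] at h
    exact latticeStep_injective (add_right_cancel h)

/-! ### Rigidity and countability of the automorphisms -/

/-- The map fixes the closed ball of radius one about `x` pointwise. -/
def FixesBall {n : ℕ} (ψ : (Fin n → ℤ) → (Fin n → ℤ)) (x : Fin n → ℤ) : Prop :=
  ψ x = x ∧ ∀ u, ψ (x + latticeStep u) = x + latticeStep u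

theorem FixesBall.step {n : ℕ} (ψ : latticeGraph n ≃g latticeGraph n) {x : Fin n → ℤ}
    (h : FixesBall ψ x) (u : Fin n × Bool) : FixesBall ψ (x + latticeStep u) := by
  refine ⟨h.2 u, ?_⟩
  -- Off the axis of `u`, the image is a common neighbour of two fixed points, and the only other
  -- candidate `x` is already the image of `x`.
  have key : ∀ v, v ≠ u → ψ (x + latticeStep u + latticeStep v) =
      x + latticeStep u + latticeStep v := by
    intro v hv
    have hadj := fun w => (ψ.map_adj_iff (v := x + latticeStep u)
      (w := x + latticeStep u + latticeStep w)).2 (latticeGraph_adj_step _ w)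
    by_cases huv : u.1 = v.1
    · have h0 : latticeStep u + latticeStep v = 0 := by
        ext k
        obtain ⟨i, s⟩ := u
        obtain ⟨j, t⟩ := v
        obtain rfl : i = j := huv
        simp only [Pi.add_apply, latticeStep_apply, Pi.zero_apply]
        cases s <;> cases t <;> simp at hv ⊢ <;> split_ifs <;> simp
      rw [add_assoc, h0, add_zero, h.1]
    · have h1 := hadj v
      rw [h.2 u] at h1
      have h2 : (latticeGraph n).Adj (ψ (x + latticeStep v))
          (ψ (x + latticeStep u + latticeStep v)) := by
        rw [ψ.map_adj_iff, add_right_comm]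
        exact latticeGraph_adj_step _ _
      rw [h.2 v] at h2
      obtain ⟨a, ha⟩ := latticeGraph_adj_iff.1 h1
      obtain ⟨b, hb⟩ := latticeGraph_adj_iff.1 h2
      have hab : latticeStep u + latticeStep a = latticeStep v + latticeStep b := by
        have := ha.symm.trans hb
        rw [add_assoc, add_assoc] at this
        exact add_left_cancel this
      rcases eq_or_eq_of_step_add_step_eq huv hab with h0 | rfl
      · exfalso
        rw [add_assoc x _ (latticeStep a), h0, add_zero] at ha
        have h3 := ψ.injective (ha.trans h.1.symm)
        have h4 := congrFun h3 u.1
        simp only [Pi.add_apply, latticeStep_apply, huv, if_true, if_false] at h4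
        split_ifs at h4 <;> omega
      · exact ha
  intro v
  -- The vertex straight ahead is the one neighbour left over by `key`.
  by_cases hv : v = u
  · subst hv
    have h1 := (ψ.map_adj_iff (v := x + latticeStep v)
      (w := x + latticeStep v + latticeStep v)).2 (latticeGraph_adj_step _ v)
    rw [h.2 v] at h1
    obtain ⟨a, ha⟩ := latticeGraph_adj_iff.1 h1
    by_cases hav : a = v
    · rwa [hav] at ha
    · have := ψ.injective (ha.trans (key a hav).symm)
      exact absurd (latticeStep_injective (add_left_cancel this)).symm hav
  · exact key v hv

theorem FixesBall.all {n : ℕ} (ψ : latticeGraph n ≃g latticeGraph n)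
    (h : FixesBall ψ 0) (x : Fin n → ℤ) : ψ x = x := by
  let S : AddSubmonoid (Fin n → ℤ) :=
    { carrier := {d | ∀ y, FixesBall ψ y → FixesBall ψ (y + d)}
      zero_mem' := fun y hy => by simpa using hy
      add_mem' := fun {a b} ha hb y hy => by
        rw [← add_assoc]
        exact hb _ (ha _ hy) }
  have hstep : ∀ u, latticeStep u ∈ S := fun u y hy => hy.step ψ u
  have hx : x ∈ S := by
    rw [← Finset.univ_sum_single x]
    refine sum_mem fun i _ => ?_
    obtain ⟨m, hm | hm⟩ := Int.eq_nat_or_neg (x i)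
    · convert nsmul_mem (hstep (i, true)) m using 1
      rw [hm, latticeStep, ← Pi.single_smul]
      simp
    · convert nsmul_mem (hstep (i, false)) m using 1
      rw [hm, latticeStep, ← Pi.single_smul]
      simp
  simpa using (hx 0 h).1

theorem countable_latticeGraph_iso (n : ℕ) : Countable (latticeGraph n ≃g latticeGraph n) := by
  let g : (latticeGraph n ≃g latticeGraph n) →
      (Fin n → ℤ) × (Fin n × Bool → Fin n → ℤ) := fun φ => (φ 0, fun u => φ (latticeStep u))
  refine Function.Injective.countable (f := g) fun φ ψ h => ?_
  have h0 : φ 0 = ψ 0 := congrArg Prod.fst h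
  have h1 : ∀ u, φ (latticeStep u) = ψ (latticeStep u) := congrFun (congrArg Prod.snd h)
  have hfix : FixesBall (φ.trans ψ.symm) 0 := by
    refine ⟨?_, fun u => ?_⟩
    · change ψ.symm (φ 0) = 0
      rw [h0]; exact ψ.symm_apply_apply 0
    · rw [zero_add]
      change ψ.symm (φ (latticeStep u)) = _
      rw [h1]; exact ψ.symm_apply_apply _
  refine RelIso.ext fun x => ?_
  have h2 : ψ.symm (φ x) = x := FixesBall.all (φ.trans ψ.symm) hfix x
  rw [← ψ.apply_symm_apply (φ x), h2]

/-! ### Twisted colourings -/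

section Construction

variable {n : ℕ}

/-- The linear form `∑ (2i + 1) x_i`, with indices starting from `0`. -/
def oddForm (x : Fin n → ℤ) : ℤ := ∑ i : Fin n, (2 * (i : ℤ) + 1) * x i

/-- The difference of the first and the last coordinate. -/
def endDiff (hn : 1 < n) (x : Fin n → ℤ) : ℤ := x ⟨0, by omega⟩ - x ⟨n - 1, by omega⟩

/-- The linear form `oddForm`, shifted by `2n` where `ε` holds at `endDiff`. -/
def twistedForm (hn : 1 < n) (ε : ℤ → Bool) (x : Fin n → ℤ) : ℤ :=
  oddForm x + 2 * n * (if ε (endDiff hn x) then 1 else 0)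

/-- The colour of a vertex: the twisted form modulo `4n`, halved. -/
def twistedColor (hn : 1 < n) (ε : ℤ → Bool) (x : Fin n → ℤ) : Fin (2 * n) :=
  ⟨((twistedForm hn ε x / 2) % (2 * n : ℤ)).toNat, by
    have h1 := Int.emod_nonneg (twistedForm hn ε x / 2) (show (2 * n : ℤ) ≠ 0 by omega)
    have h2 := Int.emod_lt_of_pos (twistedForm hn ε x / 2) (show (0 : ℤ) < 2 * n by omega)
    omega⟩

theorem oddForm_add_step (x : Fin n → ℤ) (u : Fin n × Bool) :
    oddForm (x + latticeStep u) =
      oddForm x + (2 * (u.1 : ℤ) + 1) * (if u.2 then 1 else -1) := by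
  simp only [oddForm, Pi.add_apply, mul_add, Finset.sum_add_distrib, latticeStep_apply]
  simp

/-- For arguments of the same parity, the colour determines the twisted form modulo `4n`. -/
theorem exists_twistedForm_sub_eq (hn : 1 < n) {ε δ : ℤ → Bool} {x y : Fin n → ℤ}
    (hpar : oddForm x % 2 = oddForm y % 2)
    (h : twistedColor hn ε x = twistedColor hn δ y) :
    ∃ k : ℤ, twistedForm hn ε x - twistedForm hn δ y = 2 * (2 * n * k) := by
  have hpar' : twistedForm hn ε x % 2 = twistedForm hn δ y % 2 := by
    simp only [twistedForm]
    rw [mul_assoc, mul_assoc, Int.add_mul_emod_self_left, Int.add_mul_emod_self_left, hpar]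
  have h1 := congrArg Fin.val h
  simp only [twistedColor] at h1
  have h2 := Int.emod_nonneg (twistedForm hn ε x / 2) (show (2 * n : ℤ) ≠ 0 by omega)
  have h3 := Int.emod_nonneg (twistedForm hn δ y / 2) (show (2 * n : ℤ) ≠ 0 by omega)
  have h4 : twistedForm hn δ y / 2 ≡ twistedForm hn ε x / 2 [ZMOD (2 * n : ℤ)] := by
    unfold Int.ModEq
    omega
  obtain ⟨k, hk⟩ := h4.dvd
  exact ⟨k, by omega⟩

theorem twistedColor_step_injective (hn : 1 < n) (ε : ℤ → Bool) (x : Fin n → ℤ) :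
    Function.Injective fun u => twistedColor hn ε (x + latticeStep u) := by
  rintro ⟨i, s⟩ ⟨j, t⟩ h
  have hpar : oddForm (x + latticeStep (i, s)) % 2 = oddForm (x + latticeStep (j, t)) % 2 := by
    rw [oddForm_add_step, oddForm_add_step]
    cases s <;> cases t <;> simp <;> omega
  obtain ⟨k, hk⟩ := exists_twistedForm_sub_eq hn hpar h
  simp only [twistedForm, oddForm_add_step] at hk
  set a : ℤ := if ε (endDiff hn (x + latticeStep (i, s))) then 1 else 0 with ha
  set b : ℤ := if ε (endDiff hn (x + latticeStep (j, t))) then 1 else 0 with hb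
  have hi := i.isLt
  have hj := j.isLt
  have hn' : (0 : ℤ) < 2 * n := by omega
  have hends : (i : ℕ) + j = n - 1 → s ≠ t → a = b := by
    intro hij hst
    have : endDiff hn (x + latticeStep (i, s)) = endDiff hn (x + latticeStep (j, t)) := by
      simp only [endDiff, Pi.add_apply, latticeStep_apply, Fin.ext_iff]
      cases s <;> cases t <;> simp at hst ⊢ <;> split_ifs <;> omega
    rw [ha, hb, this]
  -- Two increments differ by at most `4n - 2`, so `|m| < 2`. If `m = ±1`, the steps form an
  -- interchanged pair; then `a = b` makes `m` even, a contradiction.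
  obtain ⟨m, hm⟩ : ∃ m : ℤ, m = 2 * k - a + b := ⟨_, rfl⟩
  have hmul : (2 * (i : ℤ) + 1) * (if s then 1 else -1) -
      (2 * (j : ℤ) + 1) * (if t then 1 else -1) = 2 * n * m := by
    rw [hm]; linarith
  have hm1 : m < 2 := by
    refine lt_of_mul_lt_mul_left (a := 2 * (n : ℤ)) ?_ hn'.le
    rw [← hmul]
    cases s <;> cases t <;> simp <;> omega
  have hm2 : -2 < m := by
    refine lt_of_mul_lt_mul_left (a := 2 * (n : ℤ)) ?_ hn'.le
    rw [← hmul]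
    cases s <;> cases t <;> simp <;> omega
  obtain rfl | rfl | rfl : m = 0 ∨ m = 1 ∨ m = -1 := by omega
  · rw [Prod.mk.injEq, Fin.ext_iff]
    cases s <;> cases t <;> simp at hmul ⊢ <;> omega
  all_goals
    have hst : s ≠ t := by
      rintro rfl
      cases s <;> simp at hmul <;> omega
    have hij : (i : ℕ) + j = n - 1 := by
      cases s <;> cases t <;> simp at hst hmul <;> omega
    have := hends hij hst
    omega

theorem twistedColor_step_bijective (hn : 1 < n) (ε : ℤ → Bool) (x : Fin n → ℤ) :
    Function.Bijective fun u => twistedColor hn ε (x + latticeStep u) :=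
  (Fintype.bijective_iff_injective_and_card _).2
    ⟨twistedColor_step_injective hn ε x, by simp [mul_comm]⟩

/-- The biased partition into colour classes of `twistedColor`. -/
def twistedPartition (hn : 1 < n) (ε : ℤ → Bool) : BiasedPartition n where
  part i := {x | twistedColor hn ε x = i}
  disjoint i j hij := Set.disjoint_left.2 fun x hi hj => hij (hi.symm.trans hj)
  cover := Set.eq_univ_of_forall fun x => Set.mem_iUnion.2 ⟨_, rfl⟩
  biased i x := by
    have hn0 : (n : ℝ) ≠ 0 := by
      have : n ≠ 0 := by omega
      exact_mod_cast this
    rw [show (2 * (1 / (2 * n)) * n : ℝ) = 1 by field_simp]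
    norm_cast
    obtain ⟨u, hu, huniq⟩ := (twistedColor_step_bijective hn ε x).existsUnique i
    refine Set.ncard_eq_one.2 ⟨x + latticeStep u, Set.eq_singleton_iff_unique_mem.2
      ⟨⟨latticeGraph_adj_step x u, hu⟩, ?_⟩⟩
    rintro y ⟨hy, hyi⟩
    obtain ⟨v, rfl⟩ := latticeGraph_adj_iff.1 hy
    rw [huniq v hyi]

theorem twistedPartition_injective (hn : 1 < n) :
    Function.Injective (twistedPartition hn) := by
  intro ε δ h
  funext k
  let x : Fin n → ℤ := Pi.single ⟨0, by omega⟩ k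
  have hx : endDiff hn x = k := by
    have : (⟨n - 1, by omega⟩ : Fin n) ≠ ⟨0, by omega⟩ := by
      simp only [ne_eq, Fin.mk.injEq]; omega
    simp [endDiff, x, this]
  have hc : twistedColor hn ε x = twistedColor hn δ x := by
    have h1 := congrFun (congrArg BiasedPartition.part h) (twistedColor hn ε x)
    have h2 : x ∈ (twistedPartition hn ε).part (twistedColor hn ε x) := rfl
    rw [h1] at h2
    exact h2.symm
  obtain ⟨m, hm⟩ := exists_twistedForm_sub_eq hn rfl hc
  simp only [twistedForm, hx] at hm
  have hm' : (2 * n : ℤ) * ((if ε k then 1 else 0) - (if δ k then 1 else 0)) =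
      2 * n * (2 * m) := by linarith
  -- The two twist bits differ by an even number, hence agree.
  have := mul_left_cancel₀ (show (2 * n : ℤ) ≠ 0 by omega) hm'
  cases hε : ε k <;> cases hδ : δ k <;> simp [hε, hδ] at this ⊢ <;> omega

end Construction

/-! ### Counting isomorphism classes -/

/-- Every isomorphism class of biased partitions is countable. -/
theorem countable_isomorphic {n : ℕ} (X : BiasedPartition n) :
    {Y : BiasedPartition n | X.Isomorphic Y}.Countable := by
  have := countable_latticeGraph_iso n
  have hsub : {Y : BiasedPartition n | X.Isomorphic Y} ⊆
      ⋃ p : (latticeGraph n ≃g latticeGraph n) × Equiv.Perm (Fin (2 * n)),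
        {Y | ∀ i, p.1 '' X.part i = Y.part (p.2 i)} := by
    rintro Y ⟨φ, σ, h⟩
    exact Set.mem_iUnion.2 ⟨(φ, σ), h⟩
  refine (Set.countable_iUnion fun p => Set.Subsingleton.countable ?_).mono hsub
  intro Y hY Z hZ
  have hp : Y.part = Z.part := by
    funext i
    rw [← p.2.apply_symm_apply i, ← hY, ← hZ]
  cases Y; cases Z; cases hp; rfl

theorem mk_biasedPartition_le (n : ℕ) :
    Cardinal.mk (BiasedPartition n) ≤ 2 ^ Cardinal.aleph0 := by
  let g : BiasedPartition n → Set (Fin (2 * n) × (Fin n → ℤ)) := fun X => {p | p.2 ∈ X.part p.1}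
  have hg : Function.Injective g := by
    intro Y Z h
    have hp : Y.part = Z.part := by
      funext i
      ext x
      exact Set.ext_iff.1 h (i, x)
    cases Y; cases Z; cases hp; rfl
  refine (Cardinal.mk_le_of_injective hg).trans ?_
  rw [Cardinal.mk_set]
  exact Cardinal.power_le_power_left two_ne_zero Cardinal.mk_le_aleph0

theorem theorem4p2 (n : ℕ) (hn : 1 < n) :
    Cardinal.mk (Quotient (BiasedPartition.isoSetoid n)) = 2 ^ Cardinal.aleph0 := by
  refine le_antisymm (Cardinal.mk_quotient_le.trans (mk_biasedPartition_le n)) ?_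
  let f : (ℤ → Bool) → Quotient (BiasedPartition.isoSetoid n) :=
    fun ε => Quotient.mk _ (twistedPartition hn ε)
  have hf : ∀ q, Cardinal.mk (f ⁻¹' {q}) ≤ Cardinal.aleph0 := by
    intro q
    induction q using Quotient.inductionOn with | h X => ?_
    rw [Cardinal.le_aleph0_iff_set_countable]
    refine ((countable_isomorphic X).preimage (twistedPartition_injective hn)).mono ?_
    intro ε hε
    exact (BiasedPartition.isomorphic_equivalence n).symm (Quotient.exact hε)
  have h := Cardinal.mk_le_mk_mul_of_mk_preimage_le f hf
  have hcard : Cardinal.mk (ℤ → Bool) = 2 ^ Cardinal.aleph0 := by simp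
  rw [hcard] at h
  -- The product of the number of classes with `ℵ₀` is at most their maximum, and Cantor's theorem
  -- rules out `ℵ₀`.
  have h1 := h.trans (Cardinal.mul_le_max _ _)
  rcases le_max_iff.1 h1 with h2 | h2
  · rcases le_max_iff.1 h2 with h3 | h3
    · exact h3
    · exact absurd h3 (not_le.2 (Cardinal.cantor _))
  · exact absurd h2 (not_le.2 (Cardinal.cantor _))
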